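/- Let $K$ be a commutative ring and let $Q$, $Q'$ be finite quivers with the same set of vertices. Let $A=\widehat{KQ}$ and $A'=\widehat{KQ'}$ be their completed path algebras (infinite $K$-linear combinations of paths, with the topology of coefficientwise convergence for discrete $K$), with idempotents $e_i\in A$, $e'_i\in A'$ given by the trivial paths. The space of potentials on $Q$ is the space of infinite linear combinations of nontrivial cycles modulo rotation of cycles, that is, the quotient of $A$ by the closed subspace spanned by all commutators and all trivial paths (equivalently, $\mathrm{HH}_0(A)$ modulo the trivial paths). A hyperpotential on $Q$ is a family $(\rho_\alpha)$ of elements of $A$, indexed by the arrows of $Q$, with $\rho_\alpha\in e_jAe_i$ for $\alpha\colon i\to j$ and $\sum_\alpha[\alpha,\rho_\alpha]=0$; it is identified with the class of $\sum_\alpha\rho_\alpha\otimes\alpha$ in the continuous Hochschild homology $\mathrm{HH}_1(A)$. A potential $W$ gives the hyperpotential $(\partial_\alpha W)_\alpha$ of its cyclic derivatives. A continuous algebra isomorphism $\varphi\colon A\to A'$ with $\varphi(e_i)=e'_i$ for all vertices $i$ induces maps $\varphi_*$ on potentials and on hyperpotentials (through $\mathrm{HH}_1$). Two potentials $W$ on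 $Q$ and $W'$ on $Q'$ are right equivalent if $\varphi_*(W)=W'$ for some such $\varphi$, and weakly right equivalent if $cW$ and $W'$ are right equivalent for some $c\in K^\times$; likewise, two hyperpotentials $\rho$ on $Q$ and $\rho'$ on $Q'$ are right equivalent if $\varphi_*(\rho)=\rho'$ for some such $\varphi$, and weakly right equivalent if $c\rho$ and $\rho'$ are right equivalent for some $c\in K^\times$. Let $W$ be a potential on $Q$ and $W'$ a potential on $Q'$. If $W$ and $W'$ are right equivalent (respectively weakly right equivalent), then the hyperpotentials $(\partial_\alpha W)_\alpha$ and $(\partial_\beta W')_\beta$ are right equivalent (respectively weakly right equivalent). Conversely, if $K$ contains $\mathbb{Q}$ and $(\partial_\alpha W)_\alpha$ and $(\partial_\beta W')_\beta$ are right equivalent (respectively weakly right equivalent) as hyperpotentials, then $W$ and $W'$ are right equivalent (respectively weakly right equivalent) as potentials. -/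

import Mathlib

/-!
Completed path algebras of quivers over a commutative ring, their continuous Hochschild complex
in low degrees, potentials, hyperpotentials, and (weak) right equivalence.

Two quivers on the same vertex set `V` are two terms of `Quiver V`, so the quiver is an explicit
argument throughout. Paths are read from left to right: `p.comp q` is first `p`, then `q`.
-/

universe u v v' w

namespace Hyper

section Splittings

variable {V : Type u} (Q : Quiver.{v} V)

/-- `splitSum Q p f` is the finite sum of `f u v` over all factorizations `p = u v` of the path `p`
(there are `length p + 1` of them). -/
def splitSum {M : Type w} [AddCommMonoid M] {i : V} :
    ∀ {j : V} (_ : Quiver.Path i j) (_ : ∀ k : V, Quiver.Path i k → Quiver.Path k j → M), M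
  | _, Quiver.Path.nil, f => f i Quiver.Path.nil Quiver.Path.nil
  | j, Quiver.Path.cons p e, f =>
      f j (Quiver.Path.cons p e) Quiver.Path.nil + splitSum p (fun k a b => f k a (Quiver.Path.cons b e))

variable {Q} {M : Type w} [AddCommMonoid M]

theorem splitSum_nil {i : V} (f : ∀ k : V, Quiver.Path i k → Quiver.Path k i → M) :
    splitSum Q (Quiver.Path.nil : Quiver.Path i i) f = f i Quiver.Path.nil Quiver.Path.nil := rfl

theorem splitSum_cons {i j l : V} (p : Quiver.Path i j) (e : j ⟶ l)
    (f : ∀ k : V, Quiver.Path i k → Quiver.Path k l → M) :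
    splitSum Q (p.cons e) f =
      f l (p.cons e) Quiver.Path.nil + splitSum Q p (fun k a b => f k a (b.cons e)) := rfl

theorem splitSum_add {i j : V} (p : Quiver.Path i j) (f g : ∀ k : V, Quiver.Path i k → Quiver.Path k j → M) :
    splitSum Q p (fun k a b => f k a b + g k a b) = splitSum Q p f + splitSum Q p g := by
  induction p with
  | nil => rfl
  | cons p e ih => simp only [splitSum_cons, ih]; abel

theorem splitSum_map {N : Type*} [AddCommMonoid N] (T : M →+ N) {i j : V} (p : Quiver.Path i j)
    (f : ∀ k : V, Quiver.Path i k → Quiver.Path k j → M) :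
    splitSum Q p (fun k a b => T (f k a b)) = T (splitSum Q p f) := by
  induction p with
  | nil => rfl
  | cons p e ih => simp only [splitSum_cons, ih, map_add]

theorem splitSum_zero {i j : V} (p : Quiver.Path i j) :
    splitSum Q p (fun _ _ _ => (0 : M)) = 0 := by
  induction p with
  | nil => rfl
  | cons p e ih => simp only [splitSum_cons, ih, add_zero]

theorem splitSum_sub {M : Type*} [AddCommGroup M] {i j : V} (p : Quiver.Path i j)
    (f g : ∀ k : V, Quiver.Path i k → Quiver.Path k j → M) :
    splitSum Q p (fun k a b => f k a b - g k a b) = splitSum Q p f - splitSum Q p g := by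
  induction p with
  | nil => rfl
  | cons p e ih => simp only [splitSum_cons, ih]; abel

/-- Both sides sum `f a b c` over all factorizations `p = a b c`. -/
theorem splitSum_assoc {i j : V} (p : Quiver.Path i j)
    (f : ∀ k l : V, Quiver.Path i k → Quiver.Path k l → Quiver.Path l j → M) :
    splitSum Q p (fun l w c => splitSum Q w (fun k a b => f k l a b c)) =
      splitSum Q p (fun k a w => splitSum Q w (fun l b c => f k l a b c)) := by
  induction p with
  | nil => rfl
  | cons p e ih => simp only [splitSum_cons, ih, splitSum_add, splitSum_nil, add_assoc]

/-- The factorizations of `e p`, where `e` is an arrow. -/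
theorem splitSum_toPath_comp {i j l : V} (e : i ⟶ j) (p : Quiver.Path j l)
    (f : ∀ k : V, Quiver.Path i k → Quiver.Path k l → M) :
    splitSum Q (e.toPath.comp p) f =
      f i Quiver.Path.nil (e.toPath.comp p) + splitSum Q p (fun k a b => f k (e.toPath.comp a) b) := by
  induction p with
  | nil => simp only [Quiver.Hom.toPath, Quiver.Path.comp_nil, splitSum_cons, splitSum_nil]; abel
  | cons p e' ih => simp only [Quiver.Path.comp_cons, splitSum_cons, ih]; abel

theorem splitSum_eq_left {i j : V} (p : Quiver.Path i j)
    (f : ∀ k : V, Quiver.Path i k → Quiver.Path k j → M)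
    (hf : ∀ k l (a : Quiver.Path i k) (e : k ⟶ l) (b : Quiver.Path l j), f l (a.cons e) b = 0) :
    splitSum Q p f = f i Quiver.Path.nil p := by
  induction p with
  | nil => rfl
  | cons p e ih =>
    rw [splitSum_cons, hf, zero_add, ih _ fun k l a e' b => hf k l a e' (b.cons e)]

theorem splitSum_eq_right {i j : V} (p : Quiver.Path i j)
    (f : ∀ k : V, Quiver.Path i k → Quiver.Path k j → M)
    (hf : ∀ k l (a : Quiver.Path i k) (b : Quiver.Path k l) (e : l ⟶ j), f k a (b.cons e) = 0) :
    splitSum Q p f = f j p Quiver.Path.nil := by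
  cases p with
  | nil => rfl
  | cons p e => simp only [splitSum_cons, hf, splitSum_zero, add_zero]

theorem exists_cons_eq_toPath_comp {i j l : V} (p : Quiver.Path i j) (e : j ⟶ l) :
    ∃ (m : V) (e₀ : i ⟶ m) (p₀ : Quiver.Path m l), p.cons e = e₀.toPath.comp p₀ := by
  induction p generalizing l with
  | nil => exact ⟨l, e, Quiver.Path.nil, rfl⟩
  | cons p e' ih =>
    obtain ⟨m, e₀, p₀, h⟩ := ih e'
    exact ⟨m, e₀, p₀.cons e, by rw [h, Quiver.Path.comp_cons]⟩

end Splittings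

section Algebra

/-- The completed path algebra of the quiver `Q` over `K`: its elements are the (possibly infinite)
`K`-linear combinations of paths, given by the family of their coefficients. -/
def CPA (K : Type w) {V : Type u} (Q : Quiver.{v} V) : Type max u v w :=
  ∀ i j : V, Quiver.Path i j → K

variable {K : Type w} [CommRing K] {V : Type u} {Q : Quiver.{v} V}

instance : AddCommGroup (CPA K Q) := inferInstanceAs (AddCommGroup (∀ i j : V, Quiver.Path i j → K))

instance : Module K (CPA K Q) := inferInstanceAs (Module K (∀ i j : V, Quiver.Path i j → K))

/-- The topology of coefficientwise convergence (`K` being discrete); for a finite quiver this is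
the adic topology of the ideal of linear combinations of nontrivial paths. -/
instance : TopologicalSpace (CPA K Q) :=
  letI : TopologicalSpace K := ⊥
  inferInstanceAs (TopologicalSpace (∀ i j : V, Quiver.Path i j → K))

namespace CPA

@[ext]
theorem ext {K : Type w} {V : Type u} {Q : Quiver.{v} V} {x y : CPA K Q}
    (h : ∀ i j (p : Quiver.Path i j), x i j p = y i j p) : x = y :=
  funext fun i => funext fun j => funext fun p => h i j p

theorem add_apply (x y : CPA K Q) (i j : V) (p : Quiver.Path i j) : (x + y) i j p = x i j p + y i j p :=
  rfl

theorem sub_apply (x y : CPA K Q) (i j : V) (p : Quiver.Path i j) : (x - y) i j p = x i j p - y i j p :=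
  rfl

theorem zero_apply (i j : V) (p : Quiver.Path i j) : (0 : CPA K Q) i j p = 0 := rfl

theorem smul_apply (c : K) (x : CPA K Q) (i j : V) (p : Quiver.Path i j) : (c • x) i j p = c * x i j p :=
  rfl

theorem sum_apply {ι : Type*} (s : Finset ι) (x : ι → CPA K Q) (i j : V) (p : Quiver.Path i j) :
    (∑ a ∈ s, x a) i j p = ∑ a ∈ s, x a i j p := by
  classical
  induction s using Finset.induction_on with
  | empty => rfl
  | insert a s ha ih => rw [Finset.sum_insert ha, Finset.sum_insert ha, add_apply, ih]

open Classical in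
/-- The path `p`, as an element of the completed path algebra. -/
noncomputable def single {i j : V} (p : Quiver.Path i j) : CPA K Q := fun k l q =>
  if (⟨k, l, q⟩ : Σ k l : V, Quiver.Path k l) = ⟨i, j, p⟩ then 1 else 0

/-- The idempotent `e_i`, the trivial path at the vertex `i`. -/
noncomputable def idem (K : Type w) [CommRing K] {V : Type u} (Q : Quiver.{v} V) (i : V) :
    CPA K Q :=
  single (Quiver.Path.nil : Quiver.Path i i)

/-- The arrow `a`, as an element of the completed path algebra. -/
noncomputable def arrow (K : Type w) [CommRing K] {V : Type u} (Q : Quiver.{v} V) {i j : V}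
    (a : i ⟶ j) : CPA K Q :=
  single a.toPath

/-- The element all of whose trivial paths have coefficient `1`, that is, `∑ i, e_i`. -/
def one : CPA K Q := fun _ _ p =>
  match p with
  | Quiver.Path.nil => 1
  | Quiver.Path.cons _ _ => 0

/-- The product: the coefficient of `p` in `x y` is the sum of `x a * y b` over all `p = a b`. -/
def mul (x y : CPA K Q) : CPA K Q := fun i j p =>
  splitSum Q p fun k a b => x i k a * y k j b

instance : One (CPA K Q) := ⟨one⟩

instance : Mul (CPA K Q) := ⟨mul⟩

theorem mul_apply (x y : CPA K Q) (i j : V) (p : Quiver.Path i j) :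
    (x * y) i j p = splitSum Q p fun k a b => x i k a * y k j b := rfl

theorem one_nil (i : V) : (1 : CPA K Q) i i Quiver.Path.nil = 1 := rfl

theorem one_cons {i j l : V} (p : Quiver.Path i j) (e : j ⟶ l) : (1 : CPA K Q) i l (p.cons e) = 0 := rfl

protected theorem mul_one (x : CPA K Q) : x * 1 = x := by
  ext i j p
  rw [mul_apply]
  cases p with
  | nil => simp [splitSum_nil, one_nil]
  | cons p e => simp [splitSum_cons, one_nil, one_cons, splitSum_zero]

protected theorem one_mul (x : CPA K Q) : 1 * x = x := by
  ext i j p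
  have key : ∀ {j : V} (p : Quiver.Path i j) (g : ∀ k : V, Quiver.Path k j → K),
      splitSum Q p (fun k a b => (1 : CPA K Q) i k a * g k b) = g i p := by
    intro j p
    induction p with
    | nil => intro g; simp [splitSum_nil, one_nil]
    | cons p e ih =>
      intro g
      rw [splitSum_cons, ih (fun k b => g k (b.cons e))]
      simp [one_cons]
  exact key p (fun k b => x k j b)

protected theorem mul_assoc (x y z : CPA K Q) : x * y * z = x * (y * z) := by
  ext i j p
  have h1 : (x * y * z) i j p = splitSum Q p fun l w c =>
      splitSum Q w fun k a b => x i k a * y k l b * z l j c := by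
    rw [mul_apply]; congr 1; funext l w c
    rw [mul_apply]
    exact (splitSum_map (AddMonoidHom.mulRight (z l j c)) w _).symm
  have h2 : (x * (y * z)) i j p = splitSum Q p fun k a w =>
      splitSum Q w fun l b c => x i k a * y k l b * z l j c := by
    rw [mul_apply]; congr 1; funext k a w
    rw [mul_apply]
    simp only [mul_assoc]
    exact (splitSum_map (AddMonoidHom.mulLeft (x i k a)) w _).symm
  rw [h1, h2]
  exact splitSum_assoc p (fun k l a b c => x i k a * y k l b * z l j c)

instance : Ring (CPA K Q) where
  __ := (inferInstance : AddCommGroup (CPA K Q))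
  mul_assoc := CPA.mul_assoc
  one_mul := CPA.one_mul
  mul_one := CPA.mul_one
  zero_mul x := by
    ext i j p; simp only [mul_apply, zero_apply, zero_mul, splitSum_zero]
  mul_zero x := by
    ext i j p; simp only [mul_apply, zero_apply, mul_zero, splitSum_zero]
  left_distrib x y z := by
    ext i j p; simp only [mul_apply, add_apply, mul_add, splitSum_add]
  right_distrib x y z := by
    ext i j p; simp only [mul_apply, add_apply, add_mul, splitSum_add]

instance : Algebra K (CPA K Q) :=
  Algebra.ofModule
    (fun c x y => by
      ext i j p
      simp only [mul_apply, smul_apply, mul_assoc]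
      exact splitSum_map (AddMonoidHom.mulLeft c) p _)
    (fun c x y => by
      ext i j p
      simp only [mul_apply, smul_apply, mul_left_comm _ c]
      exact splitSum_map (AddMonoidHom.mulLeft c) p _)

end CPA

end Algebra

section Hochschild

/-- The completed tensor square of the completed path algebra: its elements are the infinite linear
combinations of the elements `p ⊗ q`, for pairs of paths `p`, `q`. -/
abbrev CPA2 (K : Type w) {V : Type u} (Q : Quiver.{v} V) : Type max u v w :=
  ∀ i j k l : V, Quiver.Path i j → Quiver.Path k l → K

/-- The completed tensor cube of the completed path algebra. -/
abbrev CPA3 (K : Type w) {V : Type u} (Q : Quiver.{v} V) : Type max u v w :=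
  ∀ i j k l m n : V, Quiver.Path i j → Quiver.Path k l → Quiver.Path m n → K

variable {K : Type w} [CommRing K] {V : Type u} {Q : Quiver.{v} V}

/-- The element `x ⊗ y` of the completed tensor square. -/
def tmul (x y : CPA K Q) : CPA2 K Q := fun i j k l p q => x i j p * y k l q

/-- The coefficients of `d₁ f`. -/
def d1Fun (f : CPA2 K Q) : CPA K Q := fun i j p =>
  splitSum Q p (fun k a b => f i k k j a b) - splitSum Q p (fun k b a => f k j i k a b)

/-- The Hochschild differential `d₁ (a ⊗ b) = a b - b a`, extended by linearity and continuity. -/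
def d1 (K : Type w) [CommRing K] {V : Type u} (Q : Quiver.{v} V) : CPA2 K Q →ₗ[K] CPA K Q where
  toFun f := d1Fun f
  map_add' f g := by
    ext i j p
    simp only [CPA.add_apply, d1Fun, Pi.add_apply, splitSum_add]
    ring
  map_smul' c f := by
    ext i j p
    simp only [CPA.smul_apply, d1Fun, Pi.smul_apply, smul_eq_mul, RingHom.id_apply, mul_sub]
    congr 1 <;> exact splitSum_map (AddMonoidHom.mulLeft c) p _

/-- The Hochschild differential `d₂ (a ⊗ b ⊗ c) = a b ⊗ c - a ⊗ b c + c a ⊗ b`, extended by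
linearity and continuity. -/
def d2 (K : Type w) [CommRing K] {V : Type u} (Q : Quiver.{v} V) : CPA3 K Q →ₗ[K] CPA2 K Q where
  toFun f := fun i j k l p q =>
    splitSum Q p (fun m a b => f i m m j k l a b q)
      - splitSum Q q (fun m b c => f i j k m m l p b c)
      + splitSum Q p (fun m c a => f m j k l i m a q c)
  map_add' f g := by
    funext i j k l p q
    simp only [Pi.add_apply, splitSum_add]
    ring
  map_smul' r f := by
    funext i j k l p q
    simp only [Pi.smul_apply, smul_eq_mul, RingHom.id_apply, mul_add, mul_sub]
    congr 1
    · congr 1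
      · exact splitSum_map (AddMonoidHom.mulLeft r) p _
      · exact splitSum_map (AddMonoidHom.mulLeft r) q _
    · exact splitSum_map (AddMonoidHom.mulLeft r) p _

end Hochschild

section Potentials

variable {K : Type w} [CommRing K] {V : Type u} {Q : Quiver.{v} V}

/-- The relations between potentials: the image of `d₁` (this is the closure of the span of the
commutators; modulo it, every path that is not a cycle is zero and every cycle equals each of its
rotations) together with the trivial paths. -/
def potentialRel (K : Type w) [CommRing K] {V : Type u} (Q : Quiver.{v} V) :
    Submodule K (CPA K Q) :=
  LinearMap.range (d1 K Q) ⊔ Submodule.span K (Set.range (CPA.idem K Q))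

/-- The space of potentials on `Q`: infinite linear combinations of nontrivial cycles, modulo
rotation of cycles. It is the quotient of the Hochschild homology `HH₀ = coker d₁` by the
trivial paths. -/
abbrev Potential (K : Type w) [CommRing K] {V : Type u} (Q : Quiver.{v} V) : Type max u v w :=
  CPA K Q ⧸ potentialRel K Q

open Classical in
/-- The coefficients of the cyclic derivative `∂_α x`, for an arrow `α : i ⟶ j`: only paths `q` from
`j` to `i` occur, and the coefficient of such a `q` is the sum of the coefficients in `x` of the
paths `b α a`, over all factorizations `q = a b`. -/
noncomputable def cyclicDerivFun {i j : V} (α : i ⟶ j) (x : CPA K Q) : CPA K Q := fun k l q =>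
  if h : k = j ∧ l = i then
    splitSum Q (q.cast h.1 h.2) (fun m a b => x m m ((b.comp α.toPath).comp a))
  else 0

theorem cyclicDerivFun_apply {i j : V} (α : i ⟶ j) (x : CPA K Q) (q : Quiver.Path j i) :
    cyclicDerivFun α x j i q = splitSum Q q (fun m a b => x m m ((b.comp α.toPath).comp a)) := by
  simp [cyclicDerivFun]

theorem cyclicDerivFun_of_not {i j : V} (α : i ⟶ j) (x : CPA K Q) {k l : V} (q : Quiver.Path k l)
    (h : ¬(k = j ∧ l = i)) : cyclicDerivFun α x k l q = 0 := by
  simp only [cyclicDerivFun, dif_neg h]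

/-- The cyclic derivative `∂_α` with respect to an arrow `α`, the continuous linear map that sends a
path `α₁ ⋯ αₙ` to the sum of `αⱼ₊₁ ⋯ αₙ α₁ ⋯ αⱼ₋₁` over all `j` with `αⱼ = α`. -/
noncomputable def cyclicDeriv (K : Type w) [CommRing K] {V : Type u} (Q : Quiver.{v} V) {i j : V}
    (α : i ⟶ j) : CPA K Q →ₗ[K] CPA K Q where
  toFun x := cyclicDerivFun α x
  map_add' x y := by
    ext k l q
    by_cases h : k = j ∧ l = i
    · obtain ⟨rfl, rfl⟩ := h
      simp only [CPA.add_apply, cyclicDerivFun_apply, splitSum_add]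
    · simp only [CPA.add_apply, cyclicDerivFun_of_not _ _ _ h, add_zero]
  map_smul' c x := by
    ext k l q
    by_cases h : k = j ∧ l = i
    · obtain ⟨rfl, rfl⟩ := h
      simp only [CPA.smul_apply, cyclicDerivFun_apply, RingHom.id_apply]
      exact splitSum_map (AddMonoidHom.mulLeft c) q _
    · simp only [CPA.smul_apply, cyclicDerivFun_of_not _ _ _ h, RingHom.id_apply, mul_zero]

theorem cyclicDeriv_apply {i j : V} (α : i ⟶ j) (x : CPA K Q) (q : Quiver.Path j i) :
    cyclicDeriv K Q α x j i q = splitSum Q q (fun m a b => x m m ((b.comp α.toPath).comp a)) :=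
  cyclicDerivFun_apply α x q

theorem cyclicDeriv_of_not {i j : V} (α : i ⟶ j) (x : CPA K Q) {k l : V} (q : Quiver.Path k l)
    (h : ¬(k = j ∧ l = i)) : cyclicDeriv K Q α x k l q = 0 :=
  cyclicDerivFun_of_not α x q h

/-- The factorizations of `b α a`, where `α` is an arrow: either inside `b` or inside `a`. -/
theorem splitSum_comp_arrow_comp {M : Type*} [AddCommMonoid M] {h i j l : V}
    (b : Quiver.Path h i) (α : i ⟶ j) (a : Quiver.Path j l)
    (f : ∀ k : V, Quiver.Path h k → Quiver.Path k l → M) :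
    splitSum Q ((b.comp α.toPath).comp a) f =
      splitSum Q b (fun k b₁ b₂ => f k b₁ ((b₂.comp α.toPath).comp a)) +
        splitSum Q a (fun k a₁ a₂ => f k ((b.comp α.toPath).comp a₁) a₂) := by
  induction a with
  | nil =>
    simp only [Quiver.Path.comp_nil, splitSum_nil, Quiver.Hom.toPath, Quiver.Path.comp_cons,
      splitSum_cons]
    abel
  | cons a e ih => simp only [Quiver.Path.comp_cons, splitSum_cons, ih]; abel

theorem cyclicDeriv_d1 {i j : V} (α : i ⟶ j) (f : CPA2 K Q) :
    cyclicDeriv K Q α (d1 K Q f) = 0 := by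
  ext k l q
  by_cases h : k = j ∧ l = i
  · obtain ⟨rfl, rfl⟩ := h
    rw [cyclicDeriv_apply, CPA.zero_apply]
    have key : ∀ m (a : Quiver.Path k m) (b : Quiver.Path m l),
        (d1 K Q f) m m ((b.comp α.toPath).comp a) =
          (splitSum Q b (fun n b₁ b₂ => f m n n m b₁ ((b₂.comp α.toPath).comp a)) +
              splitSum Q a (fun n a₁ a₂ => f m n n m ((b.comp α.toPath).comp a₁) a₂)) -
            (splitSum Q b (fun n b₁ b₂ => f n m m n ((b₂.comp α.toPath).comp a) b₁) +
              splitSum Q a (fun n a₁ a₂ => f n m m n a₂ ((b.comp α.toPath).comp a₁))) := by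
      intro m a b
      change splitSum (M := K) Q _ _ - splitSum (M := K) Q _ _ = _
      rw [splitSum_comp_arrow_comp, splitSum_comp_arrow_comp]
    simp only [key, splitSum_sub, splitSum_add]
    rw [← splitSum_assoc (M := K) q (fun m n a b₁ b₂ => (f m n n m b₁ ((b₂.comp α.toPath).comp a) : K)),
      ← splitSum_assoc q (fun m n a b₁ b₂ => (f n m m n ((b₂.comp α.toPath).comp a) b₁ : K))]
    abel
  · rw [cyclicDeriv_of_not _ _ _ h, CPA.zero_apply]

theorem cyclicDeriv_idem {i j : V} (α : i ⟶ j) (k : V) :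
    cyclicDeriv K Q α (CPA.idem K Q k) = 0 := by
  ext m n q
  by_cases h : m = j ∧ n = i
  · obtain ⟨rfl, rfl⟩ := h
    rw [cyclicDeriv_apply, CPA.zero_apply]
    have : ∀ l (a : Quiver.Path m l) (b : Quiver.Path l n),
        CPA.idem K Q k l l ((b.comp α.toPath).comp a) = 0 := by
      intro l a b
      unfold CPA.idem CPA.single
      rw [if_neg]
      intro h
      obtain ⟨rfl, h⟩ := Sigma.mk.inj_iff.1 h
      have h := congrArg Quiver.Path.length (eq_of_heq (Sigma.mk.inj_iff.1 (eq_of_heq h)).2)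
      simp at h
    simp only [this, splitSum_zero]
  · rw [cyclicDeriv_of_not _ _ _ h, CPA.zero_apply]

theorem potentialRel_le_ker {i j : V} (α : i ⟶ j) :
    potentialRel K Q ≤ LinearMap.ker (cyclicDeriv K Q α) := by
  refine sup_le ?_ (Submodule.span_le.2 ?_)
  · rintro _ ⟨f, rfl⟩
    exact cyclicDeriv_d1 α f
  · rintro _ ⟨k, rfl⟩
    exact cyclicDeriv_idem α k

end Potentials

section Hyperpotentials

variable {K : Type w} [CommRing K] {V : Type u} {Q : Quiver.{v} V}

/-- The (finite) sum over all arrows of a finite quiver. -/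
def arrowSum {M : Type*} [AddCommMonoid M] {V : Type u} [Fintype V] (Q : Quiver.{v} V)
    [∀ i j : V, Fintype (Q.Hom i j)] (f : ∀ i j : V, (i ⟶ j) → M) : M :=
  ∑ i, ∑ j, ∑ a : i ⟶ j, f i j a

/-- A hyperpotential on `Q`: a family of elements `ρ_α` of the completed path algebra, indexed by
the arrows, such that for `α : i ⟶ j` only paths from `j` to `i` occur in `ρ_α`, and such that the
sum of the commutators `[α, ρ_α]` is zero. -/
structure Hyperpotential (K : Type w) [CommRing K] {V : Type u} [Fintype V] (Q : Quiver.{v} V)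
    [∀ i j : V, Fintype (Q.Hom i j)] where
  ρ : ∀ i j : V, (i ⟶ j) → CPA K Q
  supp : ∀ (i j : V) (α : i ⟶ j) (k l : V) (p : Quiver.Path k l),
    ρ i j α k l p ≠ 0 → k = j ∧ l = i
  comm : arrowSum Q (fun i j α => CPA.arrow K Q α * ρ i j α - ρ i j α * CPA.arrow K Q α) = 0

theorem CPA.arrow_nil {i j k : V} (α : i ⟶ j) :
    CPA.arrow K Q α k k Quiver.Path.nil = 0 := by
  unfold CPA.arrow CPA.single
  rw [if_neg]
  intro h
  obtain ⟨rfl, h⟩ := Sigma.mk.inj_iff.1 h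
  obtain ⟨rfl, h⟩ := Sigma.mk.inj_iff.1 (eq_of_heq h)
  exact absurd (congrArg Quiver.Path.length (eq_of_heq h)) (by simp)

theorem CPA.arrow_of_length {i j k l : V} (α : i ⟶ j) (p : Quiver.Path k l) (hp : p.length ≠ 1) :
    CPA.arrow K Q α k l p = 0 := by
  unfold CPA.arrow CPA.single
  rw [if_neg]
  intro h
  obtain ⟨rfl, h⟩ := Sigma.mk.inj_iff.1 h
  obtain ⟨rfl, h⟩ := Sigma.mk.inj_iff.1 (eq_of_heq h)
  exact hp (by rw [eq_of_heq h]; rfl)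

theorem CPA.arrow_self {i j : V} (α : i ⟶ j) : CPA.arrow K Q α i j α.toPath = 1 := by
  unfold CPA.arrow CPA.single
  rw [if_pos rfl]

theorem CPA.arrow_ne {i j k l : V} (α : i ⟶ j) (β : k ⟶ l)
    (h : (⟨k, l, β⟩ : Σ k l : V, k ⟶ l) ≠ ⟨i, j, α⟩) : CPA.arrow K Q α k l β.toPath = 0 := by
  unfold CPA.arrow CPA.single
  rw [if_neg]
  intro h'
  apply h
  obtain ⟨rfl, h'⟩ := Sigma.mk.inj_iff.1 h'
  obtain ⟨rfl, h'⟩ := Sigma.mk.inj_iff.1 (eq_of_heq h')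
  have h'' := eq_of_heq h'
  simp only [Quiver.Hom.toPath, Quiver.Path.cons.injEq, heq_eq_eq, true_and] at h''
  rw [h'']

theorem CPA.arrow_mul_apply {i j k m l : V} (α : i ⟶ j) (x : CPA K Q) (e : k ⟶ m)
    (p : Quiver.Path m l) :
    (CPA.arrow K Q α * x) k l (e.toPath.comp p) = CPA.arrow K Q α k m e.toPath * x m l p := by
  rw [CPA.mul_apply, splitSum_toPath_comp, CPA.arrow_nil, zero_mul, zero_add, splitSum_eq_left]
  · rfl
  · intro n n' a e' b
    rw [CPA.arrow_of_length, zero_mul]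
    simp

theorem CPA.mul_arrow_apply {i j k m l : V} (α : i ⟶ j) (x : CPA K Q) (p : Quiver.Path k m)
    (e : m ⟶ l) :
    (x * CPA.arrow K Q α) k l (p.cons e) = x k m p * CPA.arrow K Q α m l e.toPath := by
  rw [CPA.mul_apply, splitSum_cons, CPA.arrow_nil, mul_zero, zero_add, splitSum_eq_right]
  · rfl
  · intro n n' a b e'
    rw [CPA.arrow_of_length, mul_zero]
    simp

variable [Fintype V] [∀ i j : V, Fintype (Q.Hom i j)]

theorem arrowSum_apply (f : ∀ i j : V, (i ⟶ j) → CPA K Q) (k l : V) (p : Quiver.Path k l) :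
    (arrowSum Q f) k l p = arrowSum Q (fun i j α => f i j α k l p) := by
  simp only [arrowSum, CPA.sum_apply]

theorem arrowSum_eq_single {M : Type*} [AddCommMonoid M] {k l : V} (e : k ⟶ l)
    (f : ∀ i j : V, (i ⟶ j) → M)
    (hf : ∀ i j (α : i ⟶ j), (⟨k, l, e⟩ : Σ k l : V, k ⟶ l) ≠ ⟨i, j, α⟩ → f i j α = 0) :
    arrowSum Q f = f k l e := by
  unfold arrowSum
  rw [Finset.sum_eq_single k, Finset.sum_eq_single l, Finset.sum_eq_single e]
  · intro α _ hα
    refine hf _ _ _ fun h => hα ?_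
    have h := eq_of_heq (Sigma.mk.inj_iff.1 h).2
    exact (eq_of_heq (Sigma.mk.inj_iff.1 h).2).symm
  · exact fun h => absurd (Finset.mem_univ _) h
  · intro j _ hj
    refine Finset.sum_eq_zero fun α _ => hf _ _ _ fun h => hj ?_
    have h := eq_of_heq (Sigma.mk.inj_iff.1 h).2
    exact (Sigma.mk.inj_iff.1 h).1.symm
  · exact fun h => absurd (Finset.mem_univ _) h
  · intro i _ hi
    refine Finset.sum_eq_zero fun j _ => Finset.sum_eq_zero fun α _ => hf _ _ _ fun h => hi ?_
    exact (Sigma.mk.inj_iff.1 h).1.symm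
  · exact fun h => absurd (Finset.mem_univ _) h

theorem cyclicDeriv_comm (x : CPA K Q) :
    arrowSum Q (fun i j (α : i ⟶ j) =>
      CPA.arrow K Q α * cyclicDeriv K Q α x - cyclicDeriv K Q α x * CPA.arrow K Q α) = 0 := by
  ext k l p
  rw [arrowSum_apply, CPA.zero_apply]
  cases p with
  | nil =>
    simp [arrowSum, CPA.sub_apply, CPA.mul_apply, splitSum_nil, CPA.arrow_nil]
  | @cons j _ p e =>
    obtain ⟨m, e₀, p₀, h⟩ := exists_cons_eq_toPath_comp p e
    have h1 : arrowSum Q (fun i j (α : i ⟶ j) =>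
        (CPA.arrow K Q α * cyclicDeriv K Q α x) k l (p.cons e)) =
          cyclicDeriv K Q e₀ x m l p₀ := by
      rw [h, arrowSum_eq_single e₀]
      · rw [CPA.arrow_mul_apply, CPA.arrow_self, one_mul]
      · intro i j α hα
        rw [CPA.arrow_mul_apply, CPA.arrow_ne _ _ hα, zero_mul]
    have h2 : arrowSum Q (fun i j (α : i ⟶ j) =>
        (cyclicDeriv K Q α x * CPA.arrow K Q α) k l (p.cons e)) =
          cyclicDeriv K Q e x k j p := by
      rw [arrowSum_eq_single e]
      · rw [CPA.mul_arrow_apply, CPA.arrow_self, mul_one]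
      · intro i j α hα
        rw [CPA.mul_arrow_apply, CPA.arrow_ne _ _ hα, mul_zero]
    have h3 : cyclicDeriv K Q e₀ x m l p₀ = cyclicDeriv K Q e x k j p := by
      by_cases hkl : k = l
      · subst hkl
        rw [cyclicDeriv_apply, cyclicDeriv_apply]
        have h4 := splitSum_toPath_comp e₀ p₀ (fun m a b => x m m (b.comp a))
        rw [← h, splitSum_cons, Quiver.Path.comp_nil, Quiver.Path.nil_comp] at h4
        have h5 := add_left_cancel h4
        simp only [← Quiver.Path.comp_assoc] at h5
        exact h5.symm
      · rw [cyclicDeriv_of_not _ _ _ fun h => hkl h.2.symm,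
          cyclicDeriv_of_not _ _ _ fun h => hkl h.1]
    simp only [arrowSum, CPA.sub_apply, Finset.sum_sub_distrib] at h1 h2 ⊢
    rw [h1, h2, h3, sub_self]

/-- The hyperpotential `(∂_α W)_α` of a potential `W`. -/
noncomputable def Potential.toHyper (W : Potential K Q) : Hyperpotential K Q where
  ρ _ _ α := (potentialRel K Q).liftQ (cyclicDeriv K Q α) (potentialRel_le_ker α) W
  supp i j α k l p := by
    obtain ⟨x, rfl⟩ := Submodule.Quotient.mk_surjective _ W
    rw [Submodule.liftQ_apply]
    exact fun h => by_contra fun h' => h (cyclicDeriv_of_not α x p h')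
  comm := by
    obtain ⟨x, rfl⟩ := Submodule.Quotient.mk_surjective _ W
    simp only [Submodule.liftQ_apply]
    exact cyclicDeriv_comm x

/-- The hyperpotential `(c ρ_α)_α`. -/
instance : SMul K (Hyperpotential K Q) where
  smul c R :=
    { ρ := fun i j α => c • R.ρ i j α
      supp := fun i j α k l p h => R.supp i j α k l p fun h' => h (by
        rw [CPA.smul_apply, h', mul_zero])
      comm := by
        have h := congrArg (fun x => c • x) R.comm
        simpa only [arrowSum, Finset.smul_sum, smul_sub, smul_zero, mul_smul_comm,
          smul_mul_assoc] using h }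

end Hyperpotentials

section Equivalence

variable {K : Type w} [CommRing K] {V : Type u} {Q : Quiver.{v} V} {Q' : Quiver.{v'} V}

/-- A continuous isomorphism of completed path algebras that maps `e_i` to `e'_i` for every
vertex `i`. -/
structure IsContVertexIso (φ : CPA K Q ≃ₐ[K] CPA K Q') : Prop where
  continuous : Continuous φ
  map_idem : ∀ i : V, φ (CPA.idem K Q i) = CPA.idem K Q' i

/-- `φ_* W = W'` for potentials: `φ_*` is the map on the spaces of potentials that is induced
by `φ`. -/
def Potential.MapsTo (φ : CPA K Q ≃ₐ[K] CPA K Q') (W : Potential K Q) (W' : Potential K Q') :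
    Prop :=
  ∀ x : CPA K Q, (potentialRel K Q).mkQ x = W → (potentialRel K Q').mkQ (φ x) = W'

variable [Fintype V] [∀ i j : V, Fintype (Q.Hom i j)] [∀ i j : V, Fintype (Q'.Hom i j)]

/-- `φ_* (ρ_α) = (ρ'_β)` for hyperpotentials. A hyperpotential `(ρ_α)` stands for the class in the
Hochschild homology `HH₁ = ker d₁ / im d₂` of the cycle `∑ α, ρ_α ⊗ α`, and `φ_*` is the map on `HH₁`
that is induced by `φ`; so the cycles `∑ α, φ ρ_α ⊗ φ α` and `∑ β, ρ'_β ⊗ β` are to be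
homologous. -/
def Hyperpotential.MapsTo (φ : CPA K Q ≃ₐ[K] CPA K Q') (R : Hyperpotential K Q)
    (R' : Hyperpotential K Q') : Prop :=
  arrowSum Q (fun i j α => tmul (φ (R.ρ i j α)) (φ (CPA.arrow K Q α))) -
    arrowSum Q' (fun i j β => tmul (R'.ρ i j β) (CPA.arrow K Q' β)) ∈ LinearMap.range (d2 K Q')

/-- Right equivalence of potentials. -/
def Potential.RightEquiv (W : Potential K Q) (W' : Potential K Q') : Prop :=
  ∃ φ : CPA K Q ≃ₐ[K] CPA K Q', IsContVertexIso φ ∧ Potential.MapsTo φ W W'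

/-- Weak right equivalence of potentials. -/
def Potential.WeakRightEquiv (W : Potential K Q) (W' : Potential K Q') : Prop :=
  ∃ c : Kˣ, Potential.RightEquiv ((c : K) • W) W'

/-- Right equivalence of hyperpotentials. -/
def Hyperpotential.RightEquiv (R : Hyperpotential K Q) (R' : Hyperpotential K Q') : Prop :=
  ∃ φ : CPA K Q ≃ₐ[K] CPA K Q', IsContVertexIso φ ∧ Hyperpotential.MapsTo φ R R'

/-- Weak right equivalence of hyperpotentials. -/
def Hyperpotential.WeakRightEquiv (R : Hyperpotential K Q) (R' : Hyperpotential K Q') : Prop :=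
  ∃ c : Kˣ, Hyperpotential.RightEquiv ((c : K) • R) R'

end Equivalence

end Hyper

/-!
# Right equivalence of potentials and of their hyperpotentials

A class in `HH₁` behaves like a noncommutative one-form: `a ⊗ b` stands for `a db`, taken up to
cyclic rotation. The hyperpotential of `W` is the form `dW`, and `φ_* dW = d(φ_* W)`; conversely a
potential over a `ℚ`-algebra is determined by its differential.

The linear maps `Θ_β = contract K Q β`, one for each arrow `β`, read off the coefficient of `dβ`,
that is, `Θ_β (a ⊗ b₁ β b₂)` contains the term `b₂ a b₁`. They vanish on boundaries
(`contract_d2`), which gives the Leibniz rule, and `Θ_β (1 ⊗ x) = ∂_β x`. Conversely an element `f`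
of the completed tensor square in which only cyclically composable pairs of paths occur is
homologous to `∑ Θ_β f ⊗ β`, by an explicit homotopy (`sub_arrowSum_contract_mem_range_d2`).
Hence `φ_* ρ = ρ'` means that `Θ_β (∑ φ ρ_α ⊗ φ α) = ρ'_β` for all `β`
(`Hyperpotential.mapsTo_iff`), and no extension of `φ` to completed tensor powers is needed.

For `ρ_α = ∂_α x` the left-hand side is `∂_β (φ x)`. This is the case `u = 1` of the functoriality
`∑ Θ_β (φ (Θ_α (u ⊗ x)) ⊗ φ α) = Θ_β (φ u ⊗ φ x)` (`chain_rule`): it follows from the Leibniz rule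
by induction when `x` is a path, and both sides are continuous in `x`. So the hyperpotentials of
`x` and `x'` correspond under `φ` if and only if `φ x - x'` has vanishing cyclic derivatives. The
relations between potentials have vanishing cyclic derivatives, and over a `ℚ`-algebra nothing else
has (`mem_potentialRel_of_cyclicDeriv_eq_zero`): if `y` is such an element and `p = e q` is a cycle
of length `n` with first arrow `e`, the coefficients of `y` at the `n` rotations of `p` sum to the
coefficient of `q` in `∂_e y`, hence to zero, and averaging over the rotations writes `y` as a sum
of commutators.
-/

namespace Hyper

/-! ### Sums over the factorizations of a path -/

section Splittings

variable {V : Type u} {Q : Quiver.{v} V} {M : Type w} [AddCommMonoid M]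

theorem splitSum_congr_of_comp {i j : V} (p : Quiver.Path i j)
    {f g : ∀ k : V, Quiver.Path i k → Quiver.Path k j → M}
    (h : ∀ k (a : Quiver.Path i k) (b : Quiver.Path k j), a.comp b = p → f k a b = g k a b) :
    splitSum Q p f = splitSum Q p g := by
  induction p with
  | nil => exact h _ _ _ rfl
  | cons p e ih =>
    rw [splitSum_cons, splitSum_cons, h _ _ _ rfl, ih fun k a b hab => h k a _ (by
      rw [Quiver.Path.comp_cons, hab])]

theorem splitSum_congr {i j : V} (p : Quiver.Path i j)
    {f g : ∀ k : V, Quiver.Path i k → Quiver.Path k j → M} (h : ∀ k a b, f k a b = g k a b) :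
    splitSum Q p f = splitSum Q p g := by
  rw [show f = g from funext fun k => funext fun a => funext fun b => h k a b]

theorem splitSum_eq_zero {i j : V} (p : Quiver.Path i j)
    {f : ∀ k : V, Quiver.Path i k → Quiver.Path k j → M} (h : ∀ k a b, f k a b = 0) :
    splitSum Q p f = 0 := by
  rw [splitSum_congr p h, splitSum_zero]

theorem splitSum_const {i j : V} (p : Quiver.Path i j) (c : M) :
    splitSum Q p (fun _ _ _ => c) = (p.length + 1) • c := by
  induction p with
  | nil => simp [splitSum_nil]
  | cons p e ih => rw [splitSum_cons, ih, Quiver.Path.length_cons, succ_nsmul' c (p.length + 1)]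

theorem splitSum_comm {i j k l : V} (p : Quiver.Path i j) (q : Quiver.Path k l)
    (f : ∀ m n : V, Quiver.Path i m → Quiver.Path m j → Quiver.Path k n → Quiver.Path n l → M) :
    splitSum Q p (fun m a b => splitSum Q q fun n c d => f m n a b c d) =
      splitSum Q q (fun n c d => splitSum Q p fun m a b => f m n a b c d) := by
  induction p with
  | nil => rfl
  | cons p e ih => simp only [splitSum_cons, splitSum_add, ih]

theorem exists_eq_toPath_comp {i j : V} (p : Quiver.Path i j) (hp : p.length ≠ 0) :
    ∃ (m : V) (e : i ⟶ m) (q : Quiver.Path m j), p = e.toPath.comp q := by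
  cases p with
  | nil => exact absurd rfl hp
  | cons p e => exact exists_cons_eq_toPath_comp p e

end Splittings

/-! ### The coefficient of an arrow in a one-form -/

section Contraction

variable {K : Type w} [CommRing K] {V : Type u} {Q : Quiver.{v} V}

open Classical in
/-- The coefficients of `Θ_β f`: the coefficient of `p` is the sum of the coefficients of
`a₁ ⊗ a₂ β c` in `f` over all factorizations `p = c a₁ a₂`. -/
noncomputable def contractFun {i j : V} (β : i ⟶ j) (f : CPA2 K Q) : CPA K Q := fun k l p =>
  if h : k = j ∧ l = i then
    splitSum Q (p.cast h.1 h.2) fun m c a => splitSum Q a fun n a₁ a₂ =>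
      f m n n m a₁ ((a₂.comp β.toPath).comp c)
  else 0

theorem contractFun_apply {i j : V} (β : i ⟶ j) (f : CPA2 K Q) (p : Quiver.Path j i) :
    contractFun β f j i p = splitSum Q p fun m c a => splitSum Q a fun n a₁ a₂ =>
      f m n n m a₁ ((a₂.comp β.toPath).comp c) := by
  simp [contractFun]

theorem contractFun_of_not {i j : V} (β : i ⟶ j) (f : CPA2 K Q) {k l : V} (p : Quiver.Path k l)
    (h : ¬(k = j ∧ l = i)) : contractFun β f k l p = 0 := by
  simp only [contractFun, dif_neg h]

/-- The continuous linear map `Θ_β` with `Θ_β (a ⊗ b) = ∑ b₂ a b₁`, summed over the factorizations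
`b = b₁ β b₂` of the path `b` (with `b₂ a b₁` read as zero unless it is a path): if `a ⊗ b` is read
as `a db`, this is the coefficient of `dβ` after the Leibniz rule and cyclic rotation. -/
noncomputable def contract (K : Type w) [CommRing K] {V : Type u} (Q : Quiver.{v} V) {i j : V}
    (β : i ⟶ j) : CPA2 K Q →ₗ[K] CPA K Q where
  toFun f := contractFun β f
  map_add' f g := by
    ext k l p
    by_cases h : k = j ∧ l = i
    · obtain ⟨rfl, rfl⟩ := h
      simp only [CPA.add_apply, contractFun_apply, Pi.add_apply, splitSum_add]
    · simp only [CPA.add_apply, contractFun_of_not _ _ _ h, add_zero]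
  map_smul' c f := by
    ext k l p
    by_cases h : k = j ∧ l = i
    · obtain ⟨rfl, rfl⟩ := h
      have hs : ∀ {i' j' : V} (q : Quiver.Path i' j')
          (F : ∀ m : V, Quiver.Path i' m → Quiver.Path m j' → K),
          splitSum Q q (fun m a b => c * F m a b) = c * splitSum Q q F :=
        fun q F => splitSum_map (AddMonoidHom.mulLeft c) q F
      simp only [CPA.smul_apply, contractFun_apply, Pi.smul_apply, smul_eq_mul, RingHom.id_apply,
        hs]
    · simp only [CPA.smul_apply, contractFun_of_not _ _ _ h, RingHom.id_apply, mul_zero]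

theorem contract_apply {i j : V} (β : i ⟶ j) (f : CPA2 K Q) (p : Quiver.Path j i) :
    contract K Q β f j i p = splitSum Q p fun m c a => splitSum Q a fun n a₁ a₂ =>
      f m n n m a₁ ((a₂.comp β.toPath).comp c) :=
  contractFun_apply β f p

theorem contract_of_not {i j : V} (β : i ⟶ j) (f : CPA2 K Q) {k l : V} (p : Quiver.Path k l)
    (h : ¬(k = j ∧ l = i)) : contract K Q β f k l p = 0 :=
  contractFun_of_not β f p h

theorem d2_apply (f : CPA3 K Q) {i j k l : V} (p : Quiver.Path i j) (q : Quiver.Path k l) :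
    d2 K Q f i j k l p q = splitSum Q p (fun m a b => f i m m j k l a b q)
      - splitSum Q q (fun m b c => f i j k m m l p b c)
      + splitSum Q p (fun m c a => f m j k l i m a q c) := rfl

theorem contract_d2 {i j : V} (β : i ⟶ j) (f : CPA3 K Q) : contract K Q β (d2 K Q f) = 0 := by
  ext k l p
  by_cases h : k = j ∧ l = i
  · obtain ⟨rfl, rfl⟩ := h
    rw [contract_apply, CPA.zero_apply]
    simp only [d2_apply, splitSum_comp_arrow_comp, splitSum_add, splitSum_sub]
    have h1 : splitSum Q p (fun m c a => splitSum Q a fun n a₁ a₂ => splitSum Q a₁ fun r x y =>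
          f m r r n n m x y ((a₂.comp β.toPath).comp c)) =
        splitSum Q p (fun m c a => splitSum Q a fun n a₁ a₂ => splitSum Q a₂ fun r x y =>
          f m n n r r m a₁ x ((y.comp β.toPath).comp c)) :=
      splitSum_congr _ fun m c a => splitSum_assoc a fun r n x y z =>
        f m r r n n m x y ((z.comp β.toPath).comp c)
    have h2 : splitSum Q p (fun m c a => splitSum Q a fun n a₁ a₂ => splitSum Q a₁ fun r z x =>
          f r n n m m r x ((a₂.comp β.toPath).comp c) z) =
        splitSum Q p (fun m c a => splitSum Q a fun n a₁ a₂ => splitSum Q c fun r c₁ c₂ =>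
          f m n n r r m a₁ ((a₂.comp β.toPath).comp c₁) c₂) := by
      calc _ = splitSum Q p (fun m c a => splitSum Q a fun r z w => splitSum Q w fun n x y =>
              f r n n m m r x ((y.comp β.toPath).comp c) z) :=
            splitSum_congr _ fun m c a => splitSum_assoc a fun r n z x y =>
              f r n n m m r x ((y.comp β.toPath).comp c) z
        _ = splitSum Q p (fun r w' w => splitSum Q w' fun m c z => splitSum Q w fun n x y =>
              f r n n m m r x ((y.comp β.toPath).comp c) z) :=
            (splitSum_assoc p fun m r c z w => splitSum Q w fun n x y =>
              f r n n m m r x ((y.comp β.toPath).comp c) z).symm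
        _ = _ := splitSum_congr _ fun r w' w => splitSum_comm w' w _
    rw [h1, h2]
    abel
  · rw [contract_of_not _ _ _ h, CPA.zero_apply]

/-- The element `x ⊗ y ⊗ z` of the completed tensor cube. -/
def tmul3 (x y z : CPA K Q) : CPA3 K Q := fun i j k l m n p q r =>
  x i j p * y k l q * z m n r

theorem d2_tmul3 (x y z : CPA K Q) :
    d2 K Q (tmul3 x y z) = tmul (x * y) z - tmul x (y * z) + tmul (z * x) y := by
  funext i j k l p q
  simp only [d2_apply, Pi.add_apply, Pi.sub_apply, tmul3, tmul, CPA.mul_apply]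
  congr 1
  · congr 1
    · exact splitSum_map (AddMonoidHom.mulRight (z k l q)) p fun m a b => x i m a * y m j b
    · simp only [mul_assoc]
      exact splitSum_map (AddMonoidHom.mulLeft (x i j p)) q fun m b c => y k m b * z m l c
  · refine Eq.trans (splitSum_congr p fun m c a => ?_)
      (splitSum_map (AddMonoidHom.mulRight (y k l q)) p fun m c a => z i m c * x m j a)
    simp only [AddMonoidHom.mulRight_apply]
    ring

/-- The Leibniz rule `a d(xy) = a x dy + y a dx`, up to cyclic rotation. -/
theorem contract_tmul_mul {i j : V} (β : i ⟶ j) (a x y : CPA K Q) :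
    contract K Q β (tmul a (x * y)) =
      contract K Q β (tmul (a * x) y) + contract K Q β (tmul (y * a) x) := by
  have h := contract_d2 β (tmul3 a x y)
  rw [d2_tmul3, map_add, map_sub] at h
  rw [sub_add_eq_add_sub, sub_eq_zero] at h
  exact h.symm

/-- If only the pairs `(a, b)` with `b` an arrow occur in `f`, then `Θ_β f` is the coefficient
of `β`. -/
theorem contract_of_length {i j : V} (β : i ⟶ j) (f : CPA2 K Q)
    (hf : ∀ (k l m n : V) (a : Quiver.Path k l) (b : Quiver.Path m n),
      b.length ≠ 1 → f k l m n a b = 0) (p : Quiver.Path j i) :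
    contract K Q β f j i p = f j i i j p β.toPath := by
  rw [contract_apply, splitSum_eq_left, splitSum_eq_right]
  · rw [Quiver.Path.comp_nil, Quiver.Path.nil_comp]
  · intro k l a b e
    exact hf _ _ _ _ _ _ (by simp)
  · intro k l a e b
    exact splitSum_eq_zero _ fun _ _ _ => hf _ _ _ _ _ _ (by simp)

theorem contract_tmul_arrow_apply {i j k l : V} (β : i ⟶ j) (α : k ⟶ l) (x : CPA K Q)
    (p : Quiver.Path j i) :
    contract K Q β (tmul x (CPA.arrow K Q α)) j i p = x j i p * CPA.arrow K Q α i j β.toPath :=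
  contract_of_length β _ (fun _ _ _ _ a b hb => by
    simp only [tmul, CPA.arrow_of_length α b hb, mul_zero]) p

theorem contract_tmul_one {i j : V} (β : i ⟶ j) (x : CPA K Q) :
    contract K Q β (tmul 1 x) = cyclicDeriv K Q β x := by
  ext k l p
  by_cases h : k = j ∧ l = i
  · obtain ⟨rfl, rfl⟩ := h
    rw [contract_apply, cyclicDeriv_apply]
    refine splitSum_congr _ fun m c a => ?_
    rw [splitSum_eq_left]
    · simp [tmul, CPA.one_nil]
    · intro n r b e b'
      simp [tmul, CPA.one_cons]
  · rw [contract_of_not _ _ _ h, cyclicDeriv_of_not _ _ _ h]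

theorem CPA.idem_of_length (k : V) {i j : V} (p : Quiver.Path i j) (hp : p.length ≠ 0) :
    CPA.idem K Q k i j p = 0 := by
  unfold CPA.idem CPA.single
  rw [if_neg]
  intro h
  obtain ⟨rfl, h⟩ := Sigma.mk.inj_iff.1 h
  obtain ⟨rfl, h⟩ := Sigma.mk.inj_iff.1 (eq_of_heq h)
  exact hp (by rw [eq_of_heq h]; rfl)

open Classical in
theorem CPA.idem_nil (k i : V) : CPA.idem K Q k i i Quiver.Path.nil = if i = k then 1 else 0 := by
  unfold CPA.idem CPA.single
  by_cases h : i = k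
  · subst h; simp
  · rw [if_neg h, if_neg]
    exact fun h' => h (Sigma.mk.inj_iff.1 h').1

open Classical in
theorem CPA.idem_mul_apply (k : V) (x : CPA K Q) {i j : V} (p : Quiver.Path i j) :
    (CPA.idem K Q k * x) i j p = if i = k then x i j p else 0 := by
  rw [CPA.mul_apply, splitSum_eq_left, CPA.idem_nil, ite_mul, one_mul, zero_mul]
  intro n n' a e b
  rw [CPA.idem_of_length _ _ (by simp), zero_mul]

open Classical in
theorem CPA.mul_idem_apply (k : V) (x : CPA K Q) {i j : V} (p : Quiver.Path i j) :
    (x * CPA.idem K Q k) i j p = if j = k then x i j p else 0 := by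
  rw [CPA.mul_apply, splitSum_eq_right, CPA.idem_nil, mul_ite, mul_one, mul_zero]
  intro n n' a b e
  rw [CPA.idem_of_length _ _ (by simp), mul_zero]

theorem CPA.idem_mul_mul_idem {x : CPA K Q} {i j : V}
    (hx : ∀ k l (p : Quiver.Path k l), x k l p ≠ 0 → k = i ∧ l = j) :
    CPA.idem K Q i * x * CPA.idem K Q j = x := by
  classical
  ext k l p
  rw [CPA.mul_idem_apply, CPA.idem_mul_apply]
  by_cases h : x k l p = 0
  · simp [h]
  · obtain ⟨rfl, rfl⟩ := hx k l p h
    simp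

theorem contract_tmul_idem {i j : V} (β : i ⟶ j) (x : CPA K Q) (k : V) :
    contract K Q β (tmul x (CPA.idem K Q k)) = 0 := by
  ext m n p
  by_cases h : m = j ∧ n = i
  · obtain ⟨rfl, rfl⟩ := h
    rw [contract_apply, CPA.zero_apply]
    refine splitSum_eq_zero _ fun _ _ _ => splitSum_eq_zero _ fun _ _ _ => ?_
    simp only [tmul]
    rw [CPA.idem_of_length _ _ (by simp), mul_zero]
  · rw [contract_of_not _ _ _ h, CPA.zero_apply]

theorem contract_tmul_idem_mul_idem {i j : V} (β : i ⟶ j) (x y : CPA K Q) (k l : V) :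
    contract K Q β (tmul x (CPA.idem K Q k * y * CPA.idem K Q l)) =
      contract K Q β (tmul (CPA.idem K Q l * x * CPA.idem K Q k) y) := by
  rw [contract_tmul_mul, contract_tmul_idem, zero_add, contract_tmul_mul, contract_tmul_idem,
    add_zero]

theorem CPA.arrow_supp {i j : V} (α : i ⟶ j) (k l : V) (p : Quiver.Path k l)
    (h : CPA.arrow K Q α k l p ≠ 0) : k = i ∧ l = j := by
  classical
  unfold CPA.arrow CPA.single at h
  have h := (ite_ne_right_iff.1 h).1
  obtain ⟨rfl, h⟩ := Sigma.mk.inj_iff.1 h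
  exact ⟨rfl, (Sigma.mk.inj_iff.1 (eq_of_heq h)).1⟩

theorem tmul_add_left (x y z : CPA K Q) : tmul (x + y) z = tmul x z + tmul y z := by
  funext i j k l p q
  exact add_mul _ _ _

theorem tmul_zero_left (z : CPA K Q) : tmul 0 z = 0 := by
  funext i j k l p q
  exact zero_mul _

theorem tmul_smul_left (c : K) (x z : CPA K Q) : tmul (c • x) z = c • tmul x z := by
  funext i j k l p q
  exact mul_assoc _ _ _

theorem tmul_smul_right (c : K) (x z : CPA K Q) : tmul x (c • z) = c • tmul x z := by
  funext i j k l p q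
  exact mul_left_comm _ _ _

theorem tmul_add_right (x y z : CPA K Q) : tmul x (y + z) = tmul x y + tmul x z := by
  funext i j k l p q
  exact mul_add _ _ _

end Contraction

/-! ### Chains that reduce one-forms to arrows -/

section Homotopy

variable {K : Type w} [CommRing K] {V : Type u} {Q : Quiver.{v} V}

open Classical in
/-- The chain that moves the arrows of `b` in `a ⊗ b` one at a time to the left:
`a ⊗ α₁ ⋯ αₙ` is sent to `- ∑ a α₁ ⋯ αₛ₋₁ ⊗ αₛ ⊗ αₛ₊₁ ⋯ αₙ`. Pairs `a`, `b` that are not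
composable are sent to zero. -/
noncomputable def shuffle (f : CPA2 K Q) : CPA3 K Q := fun i j k l m n a b c =>
  if h : j = k ∧ l = m then
    if b.length = 1 then
      -splitSum Q a fun r a₁ a₂ =>
        f i r r n a₁ ((a₂.comp (b.cast h.1.symm rfl)).comp (c.cast h.2.symm rfl))
    else 0
  else 0

theorem shuffle_apply (f : CPA2 K Q) {i j l n : V} (a : Quiver.Path i j) (b : Quiver.Path j l)
    (c : Quiver.Path l n) (hb : b.length = 1) :
    shuffle f i j j l l n a b c =
      -splitSum Q a fun r a₁ a₂ => f i r r n a₁ ((a₂.comp b).comp c) := by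
  simp [shuffle, hb]

theorem shuffle_of_length (f : CPA2 K Q) {i j k l m n : V} (a : Quiver.Path i j)
    (b : Quiver.Path k l) (c : Quiver.Path m n) (hb : b.length ≠ 1) :
    shuffle f i j k l m n a b c = 0 := by
  simp [shuffle, hb]

theorem shuffle_of_not (f : CPA2 K Q) {i j k l m n : V} (a : Quiver.Path i j)
    (b : Quiver.Path k l) (c : Quiver.Path m n) (h : ¬(j = k ∧ l = m)) :
    shuffle f i j k l m n a b c = 0 := by
  simp only [shuffle, dif_neg h]

theorem splitSum_shuffle_left (f : CPA2 K Q) {i j l : V} (p : Quiver.Path i j)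
    (q : Quiver.Path j l) :
    splitSum Q p (fun m a b => shuffle f i m m j j l a b q) =
      f i j j l p q - splitSum Q p fun r a₁ a₂ => f i r r l a₁ (a₂.comp q) := by
  cases p with
  | nil =>
    rw [splitSum_nil, splitSum_nil, shuffle_of_length _ _ _ _ (by simp), Quiver.Path.nil_comp,
      sub_self]
  | cons p e =>
    rw [splitSum_cons, shuffle_of_length _ _ _ _ (by simp), zero_add, splitSum_eq_right]
    · rw [shuffle_apply _ _ _ _ (by simp), splitSum_cons, Quiver.Path.nil_comp]
      simp only [Quiver.Path.comp_cons, Quiver.Path.comp_nil]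
      abel
    · intro k l a b e'
      exact shuffle_of_length _ _ _ _ (by simp)

theorem splitSum_shuffle_right (f : CPA2 K Q) {i j l : V} (p : Quiver.Path i j)
    (q : Quiver.Path j l) (hq : q.length ≠ 0) :
    splitSum Q q (fun m b c => shuffle f i j j m m l p b c) =
      -splitSum Q p fun r a₁ a₂ => f i r r l a₁ (a₂.comp q) := by
  obtain ⟨m, e, q, rfl⟩ := exists_eq_toPath_comp q hq
  rw [splitSum_toPath_comp, shuffle_of_length _ _ _ _ (by simp), zero_add, splitSum_eq_left]
  · rw [Quiver.Path.comp_nil, shuffle_apply _ _ _ _ (by simp)]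
    simp only [Quiver.Path.comp_assoc]
  · intro k l a e' b
    exact shuffle_of_length _ _ _ _ (by simp)

theorem splitSum_shuffle_rotate (f : CPA2 K Q) {i j : V} (p : Quiver.Path i j) (e : j ⟶ i) :
    splitSum Q p (fun m c a => shuffle f m j j i i m a e.toPath c) = -contract K Q e f i j p := by
  rw [contract_apply]
  refine Eq.trans (splitSum_congr p fun m c a => ?_)
    (splitSum_map (-AddMonoidHom.id K) p fun m c a => splitSum Q a fun n a₁ a₂ =>
      f m n n m a₁ ((a₂.comp e.toPath).comp c))
  rw [shuffle_apply _ _ _ _ (by simp)]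
  rfl

open Classical in
/-- The sum of `xₚ p ⊗ e ⊗ e` over all paths `p`, where `e` is the trivial path at the end of `p`. -/
noncomputable def padTrivial (x : CPA K Q) : CPA3 K Q := fun i j k l m _ a b c =>
  if j = k ∧ l = m ∧ b.length = 0 ∧ c.length = 0 then x i j a else 0

open Classical in
theorem d2_padTrivial (x : CPA K Q) {i j k l : V} (p : Quiver.Path i j) (q : Quiver.Path k l) :
    d2 K Q (padTrivial x) i j k l p q =
      if j = k ∧ l = i ∧ q.length = 0 then x i j p else 0 := by
  have h1 : splitSum Q p (fun m a b => padTrivial x i m m j k l a b q) =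
      if j = k ∧ q.length = 0 then x i j p else 0 := by
    rw [splitSum_eq_right]
    · simp [padTrivial]
    · intros; simp [padTrivial]
  have h2 : splitSum Q q (fun m b c => padTrivial x i j k m m l p b c) =
      if j = k ∧ q.length = 0 then x i j p else 0 := by
    rw [splitSum_eq_left]
    · simp [padTrivial]
    · intros; simp [padTrivial]
  have h3 : splitSum Q p (fun m c a => padTrivial x m j k l i m a q c) =
      if j = k ∧ l = i ∧ q.length = 0 then x i j p else 0 := by
    rw [splitSum_eq_left]
    · simp [padTrivial]
    · intros; simp [padTrivial]
  rw [d2_apply, h1, h2, h3, sub_self, zero_add]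

end Homotopy

/-! ### Arrows span the first homology -/

section Homology

variable {K : Type w} [CommRing K] {V : Type u} {Q : Quiver.{v} V}

theorem contract_tmul_arrow_self {i j : V} (α : i ⟶ j) (x : CPA K Q) :
    contract K Q α (tmul x (CPA.arrow K Q α)) = CPA.idem K Q j * x * CPA.idem K Q i := by
  classical
  ext k l p
  rw [CPA.mul_idem_apply, CPA.idem_mul_apply]
  by_cases h : k = j ∧ l = i
  · obtain ⟨rfl, rfl⟩ := h
    rw [contract_tmul_arrow_apply, CPA.arrow_self, mul_one, if_pos rfl, if_pos rfl]
  · rw [contract_of_not _ _ _ h]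
    split_ifs with h1 h2
    · exact absurd ⟨h2, h1⟩ h
    · rfl
    · rfl

theorem contract_tmul_arrow_ne {i j k l : V} (β : i ⟶ j) (α : k ⟶ l) (x : CPA K Q)
    (h : (⟨i, j, β⟩ : Σ i j : V, i ⟶ j) ≠ ⟨k, l, α⟩) :
    contract K Q β (tmul x (CPA.arrow K Q α)) = 0 := by
  ext m n p
  by_cases h' : m = j ∧ n = i
  · obtain ⟨rfl, rfl⟩ := h'
    rw [contract_tmul_arrow_apply, CPA.arrow_ne _ _ h, mul_zero, CPA.zero_apply]
  · rw [contract_of_not _ _ _ h', CPA.zero_apply]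

variable [Fintype V] [∀ i j : V, Fintype (Q.Hom i j)]

theorem arrowSum_tmul_arrow_apply (ρ : ∀ i j : V, (i ⟶ j) → CPA K Q) {i j k l : V}
    (p : Quiver.Path i j) (e : k ⟶ l) :
    arrowSum Q (fun i j β => tmul (ρ i j β) (CPA.arrow K Q β)) i j k l p e.toPath =
      ρ k l e i j p := by
  have h : arrowSum Q (fun i j β => tmul (ρ i j β) (CPA.arrow K Q β)) i j k l p e.toPath =
      arrowSum Q fun m n β => ρ m n β i j p * CPA.arrow K Q β k l e.toPath := by
    simp only [arrowSum, Finset.sum_apply, tmul]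
  rw [h, arrowSum_eq_single e, CPA.arrow_self, mul_one]
  intro m n α hα
  rw [CPA.arrow_ne _ _ hα, mul_zero]

theorem arrowSum_tmul_arrow_of_length (ρ : ∀ i j : V, (i ⟶ j) → CPA K Q) {i j k l : V}
    (p : Quiver.Path i j) (q : Quiver.Path k l) (hq : q.length ≠ 1) :
    arrowSum Q (fun i j β => tmul (ρ i j β) (CPA.arrow K Q β)) i j k l p q = 0 := by
  simp only [arrowSum, Finset.sum_apply, tmul, CPA.arrow_of_length _ _ hq, mul_zero,
    Finset.sum_const_zero]

/-- The homotopy that makes the arrows span `HH₁`: an element `f` of the completed tensor square is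
homologous to `∑ Θ_β f ⊗ β`, provided that only pairs of paths that form a cycle occur in `f`. -/
theorem sub_arrowSum_contract_mem_range_d2 (f : CPA2 K Q)
    (hf : ∀ (i j k l : V) (p : Quiver.Path i j) (q : Quiver.Path k l),
      f i j k l p q ≠ 0 → j = k ∧ l = i) :
    f - arrowSum Q (fun _ _ β => tmul (contract K Q β f) (CPA.arrow K Q β)) ∈
      LinearMap.range (d2 K Q) := by
  classical
  -- the product `∑ a b`, whose tensors with trivial paths are what `shuffle` leaves over
  obtain ⟨m, hm⟩ : ∃ m : CPA K Q, ∀ i j (p : Quiver.Path i j),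
      m i j p = splitSum Q p fun r a₁ a₂ => f i r r j a₁ a₂ := ⟨_, fun _ _ _ => rfl⟩
  refine ⟨shuffle f + padTrivial m, ?_⟩
  funext i j k l p q
  simp only [map_add, Pi.add_apply, Pi.sub_apply]
  rw [d2_padTrivial, d2_apply, hm]
  have hE : ∀ (h : ¬(j = k ∧ l = i)),
      arrowSum Q (fun _ _ β => tmul (contract K Q β f) (CPA.arrow K Q β)) i j k l p q = 0 := by
    intro h
    by_cases hq : q.length = 1
    · obtain ⟨m, e, q, rfl⟩ := exists_eq_toPath_comp q (by omega)
      obtain rfl := Quiver.Path.eq_of_length_zero q (by simpa using hq)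
      obtain rfl := Quiver.Path.eq_nil_of_length_zero q (by simpa using hq)
      rw [Quiver.Path.comp_nil, arrowSum_tmul_arrow_apply, contract_of_not]
      exact fun h' => h ⟨h'.2, h'.1.symm⟩
    · exact arrowSum_tmul_arrow_of_length _ _ _ hq
  by_cases hjk : j = k
  swap
  · rw [hE fun h => hjk h.1, by_contra fun h => hjk (hf i j k l p q h).1,
      splitSum_eq_zero, splitSum_eq_zero, splitSum_eq_zero, if_neg fun h => hjk h.1]
    · simp
    all_goals
      intros
      exact shuffle_of_not _ _ _ _ (by tauto)
  subst hjk
  have hC : splitSum Q p (fun m c a => shuffle f m j j l i m a q c) =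
      -arrowSum Q (fun _ _ β => tmul (contract K Q β f) (CPA.arrow K Q β)) i j j l p q := by
    by_cases hli : l = i
    swap
    · rw [hE fun h => hli h.2, neg_zero]
      exact splitSum_eq_zero _ fun _ _ _ => shuffle_of_not _ _ _ _ (by tauto)
    subst hli
    by_cases hq : q.length = 1
    · obtain ⟨m, e, q, rfl⟩ := exists_eq_toPath_comp q (by omega)
      obtain rfl := Quiver.Path.eq_of_length_zero q (by simpa using hq)
      obtain rfl := Quiver.Path.eq_nil_of_length_zero q (by simpa using hq)
      rw [Quiver.Path.comp_nil, arrowSum_tmul_arrow_apply, splitSum_shuffle_rotate]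
    · rw [arrowSum_tmul_arrow_of_length _ _ _ hq, neg_zero]
      exact splitSum_eq_zero _ fun _ _ _ => shuffle_of_length _ _ _ _ hq
  rw [hC, splitSum_shuffle_left]
  by_cases hq : q.length = 0
  · obtain rfl := Quiver.Path.eq_of_length_zero q hq
    obtain rfl := Quiver.Path.eq_nil_of_length_zero q hq
    rw [splitSum_nil, shuffle_of_length _ _ _ _ (by simp)]
    simp only [Quiver.Path.comp_nil]
    by_cases hji : j = i
    · rw [if_pos ⟨trivial, hji, rfl⟩]
      ring
    · rw [if_neg fun h => hji h.2.1, splitSum_eq_zero p fun r a b =>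
        by_contra fun h => hji (hf _ _ _ _ a b h).2]
      ring
  · rw [splitSum_shuffle_right _ _ _ hq, if_neg fun h => hq h.2.2]
    ring

theorem map_arrowSum {M N : Type*} [AddCommMonoid M] [AddCommMonoid N] (T : M →+ N)
    (f : ∀ i j : V, (i ⟶ j) → M) :
    T (arrowSum Q f) = arrowSum Q fun i j α => T (f i j α) := by
  simp only [arrowSum, map_sum]

theorem arrowSum_zero {M : Type*} [AddCommMonoid M] :
    arrowSum Q (fun _ _ _ => (0 : M)) = 0 := by
  simp only [arrowSum, Finset.sum_const_zero]

theorem contract_arrowSum_tmul_arrow (R : Hyperpotential K Q) {i j : V} (β : i ⟶ j) :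
    contract K Q β (arrowSum Q fun i j α => tmul (R.ρ i j α) (CPA.arrow K Q α)) = R.ρ i j β := by
  refine (map_arrowSum (contract K Q β).toAddMonoidHom _).trans ?_
  rw [arrowSum_eq_single β]
  · exact (contract_tmul_arrow_self β _).trans (CPA.idem_mul_mul_idem (R.supp i j β))
  · intro k l α hα
    exact contract_tmul_arrow_ne β α _ hα

end Homology

/-! ### Continuous maps are determined by paths -/

section Topology

variable {K : Type w} [CommRing K] {V : Type u} {Q' : Quiver.{v'} V} {Q : Quiver.{v} V}

theorem CPA.continuous_coeff {K : Type w} {V : Type u} {Q : Quiver.{v} V}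
    [TopologicalSpace K] [DiscreteTopology K] {i j : V} (p : Quiver.Path i j) :
    Continuous fun x : CPA K Q => x i j p := by
  obtain rfl := DiscreteTopology.eq_bot (α := K)
  let _ : TopologicalSpace K := ⊥
  exact (continuous_apply p).comp ((continuous_apply j).comp
    (continuous_apply (A := fun i => ∀ j, Quiver.Path i j → K) i))

theorem CPA.continuous_of_coeff {K : Type w} {V : Type u} {Q : Quiver.{v} V}
    [TopologicalSpace K] [DiscreteTopology K] {X : Type*} [TopologicalSpace X] {F : X → CPA K Q}
    (h : ∀ i j (p : Quiver.Path i j), Continuous fun x => F x i j p) : Continuous F := by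
  obtain rfl := DiscreteTopology.eq_bot (α := K)
  let _ : TopologicalSpace K := ⊥
  exact continuous_pi (A := fun i => ∀ j, Quiver.Path i j → K) fun i => continuous_pi fun j =>
    continuous_pi fun p => h i j p

theorem continuous_splitSum [TopologicalSpace K] [DiscreteTopology K] {X : Type*}
    [TopologicalSpace X] {i j : V} (p : Quiver.Path i j)
    {F : X → ∀ k : V, Quiver.Path i k → Quiver.Path k j → K}
    (h : ∀ k a b, Continuous fun x => F x k a b) : Continuous fun x => splitSum Q p (F x) := by
  induction p with
  | nil => exact h _ _ _
  | cons p e ih =>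
    simp only [splitSum_cons]
    exact (h _ _ _).add (ih fun k a b => h _ _ _)

/-- Every element is the sum of its coefficients times paths. -/
theorem CPA.hasSum_single (x : CPA K Q) :
    HasSum (fun P : Σ i j : V, Quiver.Path i j => x P.1 P.2.1 P.2.2 • CPA.single P.2.2) x := by
  classical
  let _ : TopologicalSpace K := ⊥
  refine (Pi.hasSum (X := fun i : V => ∀ j, Quiver.Path i j → K)).2 fun i =>
    Pi.hasSum.2 fun j => Pi.hasSum.2 fun p => ?_
  have h := _root_.hasSum_single (f := fun P : Σ i j : V, Quiver.Path i j =>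
    (x P.1 P.2.1 P.2.2 • (CPA.single P.2.2 : CPA K Q)) i j p) ⟨i, j, p⟩ fun P hP => by
      rw [CPA.smul_apply, CPA.single, if_neg fun h => hP h.symm, mul_zero]
  convert h using 1
  rw [CPA.smul_apply, CPA.single, if_pos rfl, mul_one]

/-- Continuous linear maps between completed path algebras are determined by their values
on paths. -/
theorem CPA.eq_of_single {S T : CPA K Q →ₗ[K] CPA K Q'} (hS : Continuous S) (hT : Continuous T)
    (h : ∀ (i j : V) (p : Quiver.Path i j), S (CPA.single p) = T (CPA.single p)) : S = T := by
  let _ : TopologicalSpace K := ⊥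
  have _ : DiscreteTopology K := ⟨rfl⟩
  refine LinearMap.ext fun x => CPA.ext fun i j p => ?_
  let ev : CPA K Q' →+ K := ⟨⟨fun y => y i j p, rfl⟩, fun _ _ => rfl⟩
  have h1 := (CPA.hasSum_single x).map (ev.comp S.toAddMonoidHom)
    ((CPA.continuous_coeff p).comp hS)
  have h2 := (CPA.hasSum_single x).map (ev.comp T.toAddMonoidHom)
    ((CPA.continuous_coeff p).comp hT)
  refine h1.unique ((congrArg (HasSum · _) (funext fun P => ?_)).mp h2)
  change ev (T (_ • CPA.single P.2.2)) = ev (S (_ • CPA.single P.2.2))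
  rw [map_smul T, map_smul S, h]

theorem continuous_contract_comp {X : Type*} [TopologicalSpace X] {i j : V} (β : i ⟶ j)
    {F G : X → CPA K Q} (hF : Continuous F) (hG : Continuous G) :
    Continuous fun x => contract K Q β (tmul (F x) (G x)) := by
  let _ : TopologicalSpace K := ⊥
  have _ : DiscreteTopology K := ⟨rfl⟩
  refine CPA.continuous_of_coeff fun k l p => ?_
  by_cases h : k = j ∧ l = i
  · obtain ⟨rfl, rfl⟩ := h
    simp only [contract_apply]
    exact continuous_splitSum _ fun m c a => continuous_splitSum _ fun n a₁ a₂ =>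
      ((CPA.continuous_coeff _).comp hF).mul ((CPA.continuous_coeff _).comp hG)
  · simp only [contract_of_not _ _ _ h]
    exact continuous_const

end Topology

/-! ### The chain rule for cyclic derivatives -/

section ChainRule

variable {K : Type w} [CommRing K] {V : Type u} {Q' : Quiver.{v'} V} {Q : Quiver.{v} V}

theorem CPA.single_cons {i j l : V} (p : Quiver.Path i j) (e : j ⟶ l) :
    (CPA.single (p.cons e) : CPA K Q) = CPA.single p * CPA.arrow K Q e := by
  classical
  ext m n q
  cases q with
  | nil =>
    rw [CPA.mul_apply, splitSum_nil, CPA.arrow_nil, mul_zero, CPA.single, if_neg]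
    intro h
    obtain ⟨rfl, h⟩ := Sigma.mk.inj_iff.1 h
    obtain ⟨rfl, h⟩ := Sigma.mk.inj_iff.1 (eq_of_heq h)
    exact absurd (congrArg Quiver.Path.length (eq_of_heq h)) (by simp)
  | @cons k _ q e' =>
    rw [CPA.mul_arrow_apply]
    by_cases h : (⟨k, n, e'⟩ : Σ k l : V, k ⟶ l) = ⟨j, l, e⟩
    · cases h
      rw [CPA.arrow_self, mul_one, CPA.single, CPA.single]
      refine if_congr ⟨fun h => ?_, fun h => ?_⟩ rfl rfl
      · cases h; rfl
      · cases h; rfl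
    · rw [CPA.arrow_ne _ _ h, mul_zero, CPA.single, if_neg]
      intro h'
      cases h'
      exact h rfl

/-- `tmul` as a bilinear map. -/
def tmulBilin (K : Type w) [CommRing K] {V : Type u} (Q : Quiver.{v} V) :
    CPA K Q →ₗ[K] CPA K Q →ₗ[K] CPA2 K Q :=
  LinearMap.mk₂ K tmul tmul_add_left tmul_smul_left tmul_add_right tmul_smul_right

variable [Fintype V] [∀ i j : V, Fintype (Q.Hom i j)]

theorem continuous_arrowSum {X : Type*} [TopologicalSpace X]
    {F : ∀ i j : V, (i ⟶ j) → X → CPA K Q'} (h : ∀ i j (α : i ⟶ j), Continuous (F i j α)) :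
    Continuous fun x => arrowSum Q fun i j α => F i j α x := by
  let _ : TopologicalSpace K := ⊥
  have _ : DiscreteTopology K := ⟨rfl⟩
  refine CPA.continuous_of_coeff fun k l p => ?_
  simp only [arrowSum, CPA.sum_apply]
  exact continuous_finsetSum _ fun i _ => continuous_finsetSum _ fun j _ =>
    continuous_finsetSum _ fun α _ => (CPA.continuous_coeff p).comp (h i j α)

theorem chain_rule_arrow {φ : CPA K Q ≃ₐ[K] CPA K Q'} (hφ : IsContVertexIso φ) {i j : V}
    (β : Q'.Hom i j) (u : CPA K Q) {k l : V} (α₀ : k ⟶ l) :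
    arrowSum Q (fun _ _ α => contract K Q' β
        (tmul (φ (contract K Q α (tmul u (CPA.arrow K Q α₀)))) (φ (CPA.arrow K Q α)))) =
      contract K Q' β (tmul (φ u) (φ (CPA.arrow K Q α₀))) := by
  rw [arrowSum_eq_single α₀, contract_tmul_arrow_self, map_mul, map_mul, hφ.map_idem,
    hφ.map_idem, ← contract_tmul_idem_mul_idem, ← hφ.map_idem, ← hφ.map_idem, ← map_mul,
    ← map_mul, CPA.idem_mul_mul_idem (CPA.arrow_supp α₀)]
  intro m n α hα
  rw [contract_tmul_arrow_ne α α₀ u hα.symm, map_zero, tmul_zero_left, map_zero]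

theorem chain_rule_single {φ : CPA K Q ≃ₐ[K] CPA K Q'} (hφ : IsContVertexIso φ) {i j : V}
    (β : Q'.Hom i j) (u : CPA K Q) {k l : V} (p : Quiver.Path k l) :
    arrowSum Q (fun _ _ α => contract K Q' β
        (tmul (φ (contract K Q α (tmul u (CPA.single p)))) (φ (CPA.arrow K Q α)))) =
      contract K Q' β (tmul (φ u) (φ (CPA.single p))) := by
  induction p generalizing u with
  | nil =>
    change arrowSum Q (fun _ _ α => contract K Q' β
        (tmul (φ (contract K Q α (tmul u (CPA.idem K Q k)))) (φ (CPA.arrow K Q α)))) =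
      contract K Q' β (tmul (φ u) (φ (CPA.idem K Q k)))
    simp only [hφ.map_idem, contract_tmul_idem, map_zero, tmul_zero_left, arrowSum_zero]
  | cons p e ih =>
    rw [CPA.single_cons, map_mul, contract_tmul_mul, ← map_mul, ← map_mul, ← ih,
      ← chain_rule_arrow hφ β]
    simp only [contract_tmul_mul, map_add, tmul_add_left, arrowSum, Finset.sum_add_distrib]

/-- The maps `Θ` are functorial. For `u = 1` this is the chain rule for cyclic derivatives. -/
theorem chain_rule {φ : CPA K Q ≃ₐ[K] CPA K Q'} (hφ : IsContVertexIso φ) {i j : V}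
    (β : Q'.Hom i j) (u x : CPA K Q) :
    arrowSum Q (fun _ _ α => contract K Q' β
        (tmul (φ (contract K Q α (tmul u x))) (φ (CPA.arrow K Q α)))) =
      contract K Q' β (tmul (φ u) (φ x)) := by
  let S : CPA K Q →ₗ[K] CPA K Q' := arrowSum Q fun _ _ α => contract K Q' β ∘ₗ
    (tmulBilin K Q').flip (φ (CPA.arrow K Q α)) ∘ₗ φ.toLinearMap ∘ₗ contract K Q α ∘ₗ
      tmulBilin K Q u
  let T : CPA K Q →ₗ[K] CPA K Q' := contract K Q' β ∘ₗ tmulBilin K Q' (φ u) ∘ₗ φ.toLinearMap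
  have hS : ∀ y, S y = arrowSum Q (fun _ _ α => contract K Q' β
      (tmul (φ (contract K Q α (tmul u y))) (φ (CPA.arrow K Q α)))) := by
    intro y
    simp only [S, arrowSum, LinearMap.sum_apply]
    rfl
  have hT : ∀ y, T y = contract K Q' β (tmul (φ u) (φ y)) := fun _ => rfl
  rw [← hS, ← hT]
  refine LinearMap.congr_fun (CPA.eq_of_single ?_ ?_ fun k l p => ?_) x
  · rw [show (S : CPA K Q → CPA K Q') = _ from funext hS]
    exact continuous_arrowSum fun _ _ α => continuous_contract_comp β
      (hφ.continuous.comp (continuous_contract_comp α continuous_const continuous_id))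
      continuous_const
  · exact continuous_contract_comp β continuous_const hφ.continuous
  · rw [hS, hT]
    exact chain_rule_single hφ β u p

end ChainRule

/-! ### Hyperpotentials up to homology -/

section Comparison

variable {K : Type w} [CommRing K] {V : Type u} {Q' : Quiver.{v'} V} {Q : Quiver.{v} V}

theorem IsContVertexIso.map_supp {φ : CPA K Q ≃ₐ[K] CPA K Q'} (hφ : IsContVertexIso φ)
    {x : CPA K Q} {i j : V} (hx : ∀ k l (p : Quiver.Path k l), x k l p ≠ 0 → k = i ∧ l = j)
    (k l : V) (p : @Quiver.Path V Q' k l) (h : φ x k l p ≠ 0) : k = i ∧ l = j := by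
  classical
  rw [← CPA.idem_mul_mul_idem hx, map_mul, map_mul, hφ.map_idem, hφ.map_idem, CPA.mul_idem_apply,
    CPA.idem_mul_apply] at h
  exact ⟨(ite_ne_right_iff.1 (ite_ne_right_iff.1 h).2).1, (ite_ne_right_iff.1 h).1⟩

variable [Fintype V] [∀ i j : V, Fintype (Q.Hom i j)] [∀ i j : V, Fintype (Q'.Hom i j)]

/-- `φ_* ρ = ρ'` is decided by the maps `Θ_β`: they vanish on boundaries, and the difference of the
two cycles involves only cyclically composable pairs of paths, so it is homologous to
`∑ Θ_β (difference) ⊗ β`. -/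
theorem Hyperpotential.mapsTo_iff {φ : CPA K Q ≃ₐ[K] CPA K Q'} (hφ : IsContVertexIso φ)
    (R : Hyperpotential K Q) (R' : Hyperpotential K Q') :
    R.MapsTo φ R' ↔ ∀ (i j : V) (β : Q'.Hom i j), contract K Q' β (arrowSum Q fun i j α =>
      tmul (φ (R.ρ i j α)) (φ (CPA.arrow K Q α))) = R'.ρ i j β := by
  constructor
  · rintro ⟨g, hg⟩ i j β
    have h := contract_d2 β g
    rw [hg, map_sub, contract_arrowSum_tmul_arrow, sub_eq_zero] at h
    exact h
  · intro h
    have hmem := sub_arrowSum_contract_mem_range_d2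
      (arrowSum Q (fun i j α => tmul (φ (R.ρ i j α)) (φ (CPA.arrow K Q α))) -
        arrowSum Q' (fun i j β => tmul (R'.ρ i j β) (CPA.arrow K Q' β))) ?_
    · have h0 : ∀ (i j : V) (β : Q'.Hom i j), contract K Q' β
          (arrowSum Q (fun i j α => tmul (φ (R.ρ i j α)) (φ (CPA.arrow K Q α))) -
            arrowSum Q' (fun i j β => tmul (R'.ρ i j β) (CPA.arrow K Q' β))) = 0 := by
        intro i j β
        rw [map_sub, contract_arrowSum_tmul_arrow, h, sub_self]
      simp only [h0, tmul_zero_left] at hmem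
      rwa [arrowSum_zero, sub_zero] at hmem
    · intro i j k l p q
      contrapose!
      intro hn
      simp only [Pi.sub_apply, arrowSum, Finset.sum_apply, tmul]
      rw [Finset.sum_eq_zero, Finset.sum_eq_zero, sub_zero]
      · refine fun a _ => Finset.sum_eq_zero fun b _ => Finset.sum_eq_zero fun β _ => ?_
        by_contra hne
        have h1 := R'.supp a b β _ _ p (left_ne_zero_of_mul hne)
        have h2 := CPA.arrow_supp β _ _ q (right_ne_zero_of_mul hne)
        exact hn (h1.2.trans h2.1.symm) (h2.2.trans h1.1.symm)
      · refine fun a _ => Finset.sum_eq_zero fun b _ => Finset.sum_eq_zero fun α _ => ?_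
        by_contra hne
        have h1 := hφ.map_supp (R.supp a b α) _ _ p (left_ne_zero_of_mul hne)
        have h2 := hφ.map_supp (CPA.arrow_supp α) _ _ q (right_ne_zero_of_mul hne)
        exact hn (h1.2.trans h2.1.symm) (h2.2.trans h1.1.symm)

theorem Potential.toHyper_mapsTo_iff {φ : CPA K Q ≃ₐ[K] CPA K Q'} (hφ : IsContVertexIso φ)
    (x : CPA K Q) (x' : CPA K Q') :
    Hyperpotential.MapsTo φ (Potential.toHyper ((potentialRel K Q).mkQ x))
        (Potential.toHyper ((potentialRel K Q').mkQ x')) ↔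
      ∀ (i j : V) (β : Q'.Hom i j), cyclicDeriv K Q' β (φ x) = cyclicDeriv K Q' β x' := by
  rw [Hyperpotential.mapsTo_iff hφ]
  refine forall_congr' fun i => forall_congr' fun j => forall_congr' fun β => ?_
  have h : contract K Q' β (arrowSum Q fun i j α => tmul
      (φ ((Potential.toHyper ((potentialRel K Q).mkQ x)).ρ i j α)) (φ (CPA.arrow K Q α))) =
        cyclicDeriv K Q' β (φ x) := by
    refine (map_arrowSum (contract K Q' β).toAddMonoidHom _).trans ?_
    rw [← contract_tmul_one, ← map_one φ, ← chain_rule hφ β 1 x]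
    simp only [contract_tmul_one]
    rfl
  rw [h]
  rfl

theorem Potential.toHyper_smul (c : K) (W : Potential K Q) : (c • W).toHyper = c • W.toHyper := by
  have h : (c • W).toHyper.ρ = (c • W.toHyper).ρ := by
    funext i j α
    exact map_smul ((potentialRel K Q).liftQ (cyclicDeriv K Q α) (potentialRel_le_ker α)) c W
  cases h1 : (c • W).toHyper
  cases h2 : c • W.toHyper
  rw [h1, h2] at h
  cases h
  rfl

theorem Potential.RightEquiv.toHyper {W : Potential K Q} {W' : Potential K Q'}
    (h : W.RightEquiv W') :
    Hyperpotential.RightEquiv (Potential.toHyper W) (Potential.toHyper W') := by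
  obtain ⟨φ, hφ, h⟩ := h
  obtain ⟨x, rfl⟩ := Submodule.mkQ_surjective _ W
  obtain rfl := h x rfl
  exact ⟨φ, hφ, (Potential.toHyper_mapsTo_iff hφ x (φ x)).2 fun _ _ _ => rfl⟩

end Comparison

/-! ### Elements with vanishing cyclic derivatives -/

section Rational

variable {K : Type w} [CommRing K] {V : Type u} {Q : Quiver.{v} V}

open Classical in
/-- The chain `∑ cₙ yₚ a ⊗ b` over all paths `p` and all factorizations `p = a b`, where `p` is
a cycle of length `n` and `b` is nontrivial, or `p` is not a cycle and `b` is trivial (and then the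
coefficient is `yₚ`). -/
noncomputable def cutChain (c : ℕ → K) (y : CPA K Q) : CPA2 K Q := fun i j k l a b =>
  if h : j = k then
    if l = i then
      if b.length = 0 then 0
      else c (a.length + b.length) * y i l (a.comp (b.cast h.symm rfl))
    else if b.length = 0 then y i l (a.comp (b.cast h.symm rfl)) else 0
  else 0

theorem splitSum_ite_length {i j : V} (p : Quiver.Path i j) (x : K) :
    splitSum Q p (fun _ _ b => if b.length = 0 then 0 else x) = p.length • x := by
  cases p with
  | nil => simp [splitSum_nil]
  | cons p e =>
    rw [splitSum_cons]
    simp [splitSum_const]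

theorem d1_apply (f : CPA2 K Q) {i j : V} (p : Quiver.Path i j) :
    d1 K Q f i j p =
      splitSum Q p (fun k a b => f i k k j a b) - splitSum Q p (fun k b a => f k j i k a b) := rfl

/-- Rotating a nontrivial cycle `e q` through all positions sums the coefficients to that of `q` in
a cyclic derivative, so `y` is a boundary up to trivial paths once its cyclic derivatives vanish
and lengths are invertible. A path `p` that is not a cycle is the commutator of `p` with the trivial
path at its end. -/
theorem mem_potentialRel_of_cyclicDeriv_eq_zero [Fintype V] (hK : Nonempty (ℚ →+* K))
    {y : CPA K Q} (hy : ∀ (i j : V) (β : i ⟶ j), cyclicDeriv K Q β y = 0) :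
    y ∈ potentialRel K Q := by
  classical
  obtain ⟨r⟩ := hK
  set c : ℕ → K := fun n => r ((n : ℚ)⁻¹) with hcdef
  have hc : ∀ n : ℕ, n ≠ 0 → (n : K) * c n = 1 := by
    intro n hn
    rw [hcdef, ← map_natCast r, ← map_mul, mul_inv_cancel₀ (Nat.cast_ne_zero.2 hn), map_one]
  refine Submodule.mem_sup.2 ⟨_, ⟨cutChain c y, rfl⟩,
    ∑ i, y i i Quiver.Path.nil • CPA.idem K Q i, Submodule.sum_mem _ fun i _ =>
      Submodule.smul_mem _ _ (Submodule.subset_span ⟨i, rfl⟩), ?_⟩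
  ext i j p
  rw [CPA.add_apply, CPA.sum_apply, d1_apply]
  simp only [CPA.smul_apply]
  by_cases hp : p.length = 0
  · obtain rfl := Quiver.Path.eq_of_length_zero p hp
    obtain rfl := Quiver.Path.eq_nil_of_length_zero p hp
    simp [splitSum_nil, cutChain, CPA.idem_nil]
  simp only [CPA.idem_of_length _ p hp, mul_zero, Finset.sum_const_zero, add_zero]
  by_cases hij : j = i
  · subst hij
    have h1 : splitSum Q p (fun k a b => cutChain c y j k k j a b) = y j j p := by
      have h : splitSum Q p (fun k a b => cutChain c y j k k j a b) =
          splitSum Q p (fun _ _ b => if b.length = 0 then 0 else c p.length * y j j p) :=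
        splitSum_congr_of_comp p fun k a b hab => by
          simp [cutChain, ← hab]
      rw [h, splitSum_ite_length, nsmul_eq_mul, ← mul_assoc, hc _ hp, one_mul]
    have h2 : splitSum Q p (fun k b a => cutChain c y k j j k a b) = 0 := by
      obtain ⟨m, e, q, rfl⟩ := exists_eq_toPath_comp p hp
      rw [splitSum_toPath_comp]
      have h : splitSum Q q (fun k b a => cutChain c y k j j k a (e.toPath.comp b)) =
          splitSum Q q fun k b a => AddMonoidHom.mulLeft (c (q.length + 1))
            (y k k ((a.comp e.toPath).comp b)) :=
        splitSum_congr_of_comp q fun k b a hab => by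
          have hl : a.length + (e.toPath.comp b).length = q.length + 1 := by
            rw [← hab, Quiver.Path.length_comp, Quiver.Path.length_comp,
              Quiver.Path.length_toPath]
            omega
          have hne : (e.toPath.comp b).length ≠ 0 := by
            rw [Quiver.Path.length_comp, Quiver.Path.length_toPath]
            omega
          rw [cutChain, dif_pos rfl, if_pos rfl, if_neg hne, hl, Quiver.Path.comp_assoc]
          rfl
      rw [h, splitSum_map, ← cyclicDeriv_apply, hy]
      simp [cutChain, CPA.zero_apply]
    rw [h1, h2, sub_zero]
  · have h1 : splitSum Q p (fun k a b => cutChain c y i k k j a b) = y i j p := by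
      rw [splitSum_eq_right]
      · simp [cutChain, hij]
      · intros; simp [cutChain, hij]
    have h2 : splitSum Q p (fun k b a => cutChain c y k j i k a b) = 0 :=
      splitSum_eq_zero _ fun k b a => dif_neg hij
    rw [h1, h2, sub_zero]

theorem Hyperpotential.RightEquiv.of_toHyper [Fintype V] [∀ i j : V, Fintype (Q.Hom i j)]
    {Q' : Quiver.{v'} V} [∀ i j : V, Fintype (Q'.Hom i j)] (hK : Nonempty (ℚ →+* K))
    {W : Potential K Q} {W' : Potential K Q'} (h : W.toHyper.RightEquiv W'.toHyper) :
    W.RightEquiv W' := by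
  obtain ⟨φ, hφ, h⟩ := h
  refine ⟨φ, hφ, ?_⟩
  rintro x rfl
  obtain ⟨x', rfl⟩ := Submodule.mkQ_surjective _ W'
  have h := (Potential.toHyper_mapsTo_iff hφ x x').1 h
  refine (Submodule.Quotient.eq _).2 (mem_potentialRel_of_cyclicDeriv_eq_zero hK fun i j β => ?_)
  rw [map_sub, h, sub_self]

end Rational

end Hyper

theorem lemmal {K : Type w} [CommRing K] {V : Type u} [Fintype V]
    (Q : Quiver.{v} V) (Q' : Quiver.{v'} V)
    [∀ i j : V, Fintype (Q.Hom i j)] [∀ i j : V, Fintype (Q'.Hom i j)]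
    (W : Hyper.Potential K Q) (W' : Hyper.Potential K Q') :
    (Hyper.Potential.RightEquiv W W' →
        Hyper.Hyperpotential.RightEquiv W.toHyper W'.toHyper) ∧
      (Hyper.Potential.WeakRightEquiv W W' →
        Hyper.Hyperpotential.WeakRightEquiv W.toHyper W'.toHyper) ∧
      (Nonempty (ℚ →+* K) →
        (Hyper.Hyperpotential.RightEquiv W.toHyper W'.toHyper →
          Hyper.Potential.RightEquiv W W') ∧
        (Hyper.Hyperpotential.WeakRightEquiv W.toHyper W'.toHyper →
          Hyper.Potential.WeakRightEquiv W W')) := by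
  refine ⟨fun h => h.toHyper, ?_, fun hK => ⟨fun h => h.of_toHyper hK, ?_⟩⟩
  · rintro ⟨c, h⟩
    exact ⟨c, Hyper.Potential.toHyper_smul (c : K) W ▸ h.toHyper⟩
  · rintro ⟨c, h⟩
    rw [← Hyper.Potential.toHyper_smul] at h
    exact ⟨c, h.of_toHyper hK⟩
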